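/- A real is an infinite binary sequence $X\in 2^{\omega}$, and $X\upharpoonright n$ is its initial segment of length $n$. A real $A$ is array noncomputable if for every function $f:\mathbb{N}\to\mathbb{N}$ with $f\le_{wtt}\emptyset'$ there is a function $g\le_T A$ with $g(n)>f(n)$ for infinitely many $n$; a Turing degree is array noncomputable if it is the degree of an array noncomputable real. A partial martingale is a partial function $f$ from $2^{<\omega}$ to the nonnegative reals whose domain is closed under prefixes and such that, whenever $f(\sigma 0)$ or $f(\sigma 1)$ is defined, both are defined and $f(\sigma)=\frac{1}{2}(f(\sigma 0)+f(\sigma 1))$; a martingale is a partial martingale that is total. It is integer-valued if, whenever $f(\sigma i)$ is defined, $f(\sigma i)=f(\sigma)\pm k$ for some $k\in\mathbb{N}$. It is [partial] computable if there is a partial computable function that, for every $\sigma$ in the domain of $f$ and every $n$, yields an approximation of $f(\sigma)$ to within $2^{-n}$, and diverges for every $\sigma$ outside the domain. It succeeds on a real $X$ if $f(X\upharpoonright n)$ is defined for all $n$ and $\limsup_{n} f(X\upharpoonright n)=\infty$. A real is partial integer-valued random if no partial computable integer-valued martingale succeeds on it, and integer-valued random if no (total) computable integer-valued martingale succeeds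 on it. **Theorem.** Every array noncomputable Turing degree computes a partial integer-valued random real, and hence an integer-valued random real: if $\mathbf{d}$ is an array noncomputable degree, there is a real $X$ with $\deg_T(X)\le\mathbf{d}$ that is partial integer-valued random and integer-valued random. -/

import Mathlib

open scoped Computability

/-- The initial segment `X ↾ n` of a real (infinite binary sequence) `X`. -/
def initSeg (X : ℕ → Bool) (n : ℕ) : List Bool :=
  (List.range n).map X

/-- A real viewed as a (total) number-theoretic function with values `0` and `1`. -/
def realFun (X : ℕ → Bool) : ℕ →. ℕ :=
  fun n => Part.some (X n).toNat

/-- The Turing degree of a real. -/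
def realDegree (X : ℕ → Bool) : TuringDegree :=
  toAntisymmetrization TuringReducible (realFun X)

/-- The halting set `∅'`, as a real: `e` belongs to it iff the `e`-th partial computable function
converges on input `e`. -/
noncomputable def haltingSet : ℕ → Bool := by
  classical
  exact fun e => decide (Nat.Partrec.Code.eval (Denumerable.ofNat Nat.Partrec.Code e) e).Dom

/-- Weak truth-table reducibility `f ≤_wtt B`: the value `f n` is computed, uniformly in `n`, from
the part of the oracle `B` below a computable bound `u n` on the use. The procedure `Φ` may diverge
when it is given a string that is not an initial segment of `B`. -/
def WttReducible (f : ℕ → ℕ) (B : ℕ → Bool) : Prop :=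
  ∃ u : ℕ → ℕ, Computable u ∧
    ∃ Φ : ℕ × List Bool →. ℕ, Partrec Φ ∧ ∀ n, f n ∈ Φ (n, initSeg B (u n))

/-- `A` is array noncomputable: for all `f ≤_wtt ∅'` there is `g ≤_T A` with `g n > f n` for
infinitely many `n`. -/
def ArrayNoncomputable (A : ℕ → Bool) : Prop :=
  ∀ f : ℕ → ℕ, WttReducible f haltingSet →
    ∃ g : ℕ → ℕ, (g : ℕ →. ℕ) ≤ᵀ realFun A ∧ ∃ᶠ n in Filter.atTop, f n < g n

/-- A Turing degree is array noncomputable if it is the degree of an array noncomputable real. -/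
def ArrayNoncomputableDegree (d : TuringDegree) : Prop :=
  ∃ A : ℕ → Bool, realDegree A = d ∧ ArrayNoncomputable A

/-- A partial martingale: a partial function from binary strings to the nonnegative reals, with
domain closed under prefixes, which obeys the fairness condition at `σ` as soon as it bets at `σ`,
that is, as soon as it is defined on one of the two children of `σ` (it is then defined on both). -/
structure IsPartialMartingale (f : List Bool →. ℝ) : Prop where
  nonneg : ∀ σ, ∀ a ∈ f σ, 0 ≤ a
  prefix_closed : ∀ σ τ : List Bool, σ <+: τ → (f τ).Dom → (f σ).Dom
  fair : ∀ (σ : List Bool) (i : Bool), (f (σ ++ [i])).Dom →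
    ∃ a ∈ f σ, ∃ b ∈ f (σ ++ [false]), ∃ c ∈ f (σ ++ [true]), a = (b + c) / 2

/-- `f` is integer-valued: each bet is a natural number of units, `f (σ i) = f σ ± k` with
`k : ℕ`. -/
def IsIntegerValued (f : List Bool →. ℝ) : Prop :=
  ∀ (σ : List Bool) (i : Bool), (f (σ ++ [i])).Dom →
    ∃ k : ℕ, ∃ a ∈ f σ, ∃ b ∈ f (σ ++ [i]), b = a + k ∨ b = a - k

/-- A partial function from strings to the nonnegative reals is partial computable if, uniformly in
`σ` in its domain and `n`, one can compute a natural number `p` with `|p / 2 ^ n - f σ| ≤ 2⁻ⁿ`,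
the computation diverging for `σ` outside the domain. -/
def IsPartialComputableReal (f : List Bool →. ℝ) : Prop :=
  ∃ g : List Bool × ℕ →. ℕ, Partrec g ∧
    (∀ σ n, (g (σ, n)).Dom ↔ (f σ).Dom) ∧
    ∀ σ n, ∀ p ∈ g (σ, n), ∀ a ∈ f σ, |(p : ℝ) / 2 ^ n - a| ≤ 1 / 2 ^ n

/-- `f` succeeds on `X`: `limsup f (X ↾ n) = ∞`, all the values `f (X ↾ n)` being defined. -/
def Succeeds (f : List Bool →. ℝ) (X : ℕ → Bool) : Prop :=
  (∀ n, (f (initSeg X n)).Dom) ∧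
    ∀ c : ℝ, ∃ᶠ n in Filter.atTop, ∃ a ∈ f (initSeg X n), c < a

/-- No partial computable integer-valued martingale succeeds on `X`. -/
def IsPartialIntegerValuedRandom (X : ℕ → Bool) : Prop :=
  ∀ f : List Bool →. ℝ, IsPartialMartingale f → IsIntegerValued f → IsPartialComputableReal f →
    ¬ Succeeds f X

/-- No (total) computable integer-valued martingale succeeds on `X`. -/
def IsIntegerValuedRandom (X : ℕ → Bool) : Prop :=
  ∀ f : List Bool → ℝ, IsPartialMartingale (f : List Bool →. ℝ) →
    IsIntegerValued (f : List Bool →. ℝ) → IsPartialComputableReal (f : List Bool →. ℝ) →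
    ¬ Succeeds (f : List Bool →. ℝ) X

/-!
An integer-valued martingale that bets loses at least `1` on one of the two sides, so it is constant
on the extensions of a string at which it has reached its least value among the extensions of that
string (`IsStagedMartingaleFamily.eq_of_minimal`). A real is therefore partial integer-valued random
as soon as it passes, for every partial computable integer-valued martingale defined along it,
through such a string. Up to a real constant these martingales are partial computable functions with
values in `ℕ` (`exists_partrec_nat_translate`), and all such martingales form one uniformly
computable family `martingaleValue`.

The real is built bit by bit. At stage `s` a search with a bound `G s` looks, for each `e ≤ s`, for
the least value of the `e`-th martingale on the extensions of the string `σ` built so far. The first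
`e` for which that value is seen to be less than the value at `σ` acts: the next bit follows the
extension that was found (`NextBit`). A larger search bound finds at least as much and ties are
resolved in favour of the first witness, so a target with the truly least value is kept until its
value is reached (`exists_value_eq_minimal`).

A martingale with initial capital `c` is at most `2 ^ s * c` on strings of length `s`. Hence, for
initial capitals up to `s`, the least values on the extensions of all the strings of length `s` are
settled by a computable finite set of `Σ₁` questions, and a bound `f s` on the least witnesses of
those with a positive answer is weak truth-table reducible to the halting set
(`exists_wttReducible_witness_bound`). An array noncomputable `A` computes a function `g` with `f s
< g s` for infinitely many `s`; with search bounds above `g`, a martingale that is defined along the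
real finds its true minimum at a large such stage after those of smaller index have stopped acting,
and never acts again once that minimum is reached; one that is not defined along the real stops
acting where it becomes undefined. By induction on the index every martingale is eventually constant
along the real (`eventually_constant_and_not_acts`), which is computable from `g`.
-/

/-! ### Staged families of martingales -/

/-- A uniform family of partial `ℕ`-valued martingales given by stages: `V t e τ = some a` says that
by stage `t` the `e`-th martingale has been seen to take the value `a` at `τ`. Values persist, and a
value at a child is only accepted together with those at its sibling and parent, which it has to
balance. -/
structure IsStagedMartingaleFamily (V : ℕ → ℕ → List Bool → Option ℕ) : Prop where
  mono : ∀ {t t' e τ a}, t ≤ t' → V t e τ = some a → V t' e τ = some a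
  fair : ∀ {t e τ i a}, V t e (τ ++ [i]) = some a →
    ∃ b c, V t e τ = some b ∧ V t e (τ ++ [!i]) = some c ∧ a + c = 2 * b

namespace IsStagedMartingaleFamily

variable {V : ℕ → ℕ → List Bool → Option ℕ} (hV : IsStagedMartingaleFamily V)
include hV

theorem unique {t t' e τ a b} (ha : V t e τ = some a) (hb : V t' e τ = some b) : a = b := by
  have h1 := hV.mono (le_max_left t t') ha
  have h2 := hV.mono (le_max_right t t') hb
  simpa [h1] using h2

theorem exists_of_prefix {t e ρ τ a} (h : ρ <+: τ) (ha : V t e τ = some a) :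
    ∃ b, V t e ρ = some b := by
  induction τ using List.reverseRecOn generalizing a with
  | nil => rw [List.prefix_nil.1 h]; exact ⟨a, ha⟩
  | append_singleton τ i ih =>
    rcases List.prefix_concat_iff.1 h with rfl | h
    · exact ⟨a, ha⟩
    · obtain ⟨b, c, hb, -, -⟩ := hV.fair ha
      exact ih h hb

theorem le_two_pow_mul {t e τ a c} (ha : V t e τ = some a) (hc : V t e [] = some c) :
    a ≤ 2 ^ τ.length * c := by
  induction τ using List.reverseRecOn generalizing a with
  | nil => simp [hV.unique ha hc]
  | append_singleton τ i ih =>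
    obtain ⟨b, d, hb, -, h⟩ := hV.fair ha
    have := ih hb
    rw [List.length_append, List.length_singleton, pow_succ]
    nlinarith

/-- Once a martingale has reached the least value that it takes on the extensions of `σ`, it is
constant there: a gain on one side would be a loss on the other. -/
theorem eq_of_minimal {t e σ v} (hσ : V t e σ = some v)
    (hmin : ∀ t τ a, σ <+: τ → V t e τ = some a → v ≤ a)
    {t' τ a} (h : σ <+: τ) (ha : V t' e τ = some a) : a = v := by
  induction τ using List.reverseRecOn generalizing a with
  | nil => rw [List.prefix_nil.1 h] at hσ; exact hV.unique ha hσ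
  | append_singleton τ i ih =>
    rcases List.prefix_concat_iff.1 h with rfl | h'
    · exact hV.unique ha hσ
    · obtain ⟨b, c, hb, hc, hbc⟩ := hV.fair ha
      have h1 := ih h' hb
      have h2 := hmin _ _ _ h ha
      have h3 := hmin _ _ _ (h'.trans (List.prefix_append _ _)) hc
      omega

end IsStagedMartingaleFamily

/-! ### Choice of the next bit -/

/-- The string component of a number `w`, which is read as a pair of a stage and a string. -/
def targetString (w : ℕ) : List Bool :=
  (Encodable.decode (α := List Bool) w.unpair.2).getD []

/-- `w` codes a stage by which the `e`-th martingale is seen to take the value `k` at the string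
coded by `w`, and that string extends `σ`. -/
def IsWitness (V : ℕ → ℕ → List Bool → Option ℕ) (e : ℕ) (σ : List Bool) (k w : ℕ) : Prop :=
  (targetString w).take σ.length = σ ∧ V w.unpair.1 e (targetString w) = some k

/-- With search bound `G`, the `e`-th martingale is seen to take a smaller value on some extension of
`σ` than at `σ`. -/
def Acts (V : ℕ → ℕ → List Bool → Option ℕ) (G : ℕ) (σ : List Bool) (e : ℕ) : Prop :=
  ∃ k < (V G e σ).getD 0, ∃ w < G, IsWitness V e σ k w

/-- `w` is the first witness below `G` for the least value that the `e`-th martingale is seen to take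
on the extensions of `σ`. -/
def IsTarget (V : ℕ → ℕ → List Bool → Option ℕ) (G : ℕ) (σ : List Bool) (e w : ℕ) : Prop :=
  ∃ k < (V G e σ).getD 0, IsWitness V e σ k w ∧
    (∀ k' < k, ∀ w' < G, ¬ IsWitness V e σ k' w') ∧ ∀ w' < w, ¬ IsWitness V e σ k w'

/-- The bit appended to `σ` with search bound `G` is `true`: the first martingale that acts has a
target which extends `σ` by `true`. -/
def NextBit (V : ℕ → ℕ → List Bool → Option ℕ) (G : ℕ) (σ : List Bool) : Prop :=
  ∃ e < σ.length + 1, Acts V G σ e ∧ (∀ e' < e, ¬ Acts V G σ e') ∧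
    ∃ w < G, IsTarget V G σ e w ∧ (targetString w)[σ.length]? = some true

theorem length_initSeg (X : ℕ → Bool) (n : ℕ) : (initSeg X n).length = n := by
  simp [initSeg]

theorem initSeg_succ (X : ℕ → Bool) (n : ℕ) : initSeg X (n + 1) = initSeg X n ++ [X n] := by
  simp [initSeg, List.range_succ]

theorem initSeg_prefix (X : ℕ → Bool) {m n : ℕ} (h : m ≤ n) : initSeg X m <+: initSeg X n := by
  induction n, h using Nat.le_induction with
  | base => exact List.prefix_rfl
  | succ n _ ih => rw [initSeg_succ]; exact ih.trans (List.prefix_append _ _)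

theorem isWitness_iff {V : ℕ → ℕ → List Bool → Option ℕ} {e σ k w} :
    IsWitness V e σ k w ↔
      σ <+: targetString w ∧ V w.unpair.1 e (targetString w) = some k := by
  rw [IsWitness, List.prefix_iff_eq_take, eq_comm]

theorem exists_isWitness {V : ℕ → ℕ → List Bool → Option ℕ} {t e σ τ k} (h : σ <+: τ)
    (hk : V t e τ = some k) : ∃ w, IsWitness V e σ k w := by
  refine ⟨Nat.pair t (Encodable.encode τ), isWitness_iff.2 ?_⟩
  simpa [targetString] using ⟨h, hk⟩

/-- The first martingale that acts decides the next bit, and its target is unique: the least value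
seen and the first witness for it are determined. -/
theorem nextBit_iff_of_isTarget {V : ℕ → ℕ → List Bool → Option ℕ} {G σ e w b}
    (he : e ≤ σ.length) (hact : Acts V G σ e) (hlow : ∀ e' < e, ¬ Acts V G σ e')
    (hw : IsTarget V G σ e w) (hwG : w < G) (hb : (targetString w)[σ.length]? = some b) :
    NextBit V G σ ↔ b = true := by
  constructor
  · rintro ⟨e', -, hact', hlow', w', hw'G, hw', hb'⟩
    have hee : e' = e := by
      rcases lt_trichotomy e' e with h | h | h
      · exact absurd hact' (hlow _ h)
      · exact h
      · exact absurd hact (hlow' _ h)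
    subst hee
    obtain ⟨k, -, h1, h2, h3⟩ := hw
    obtain ⟨k', -, h1', h2', h3'⟩ := hw'
    have hk : k = k' := by
      rcases lt_trichotomy k k' with h | h | h
      · exact absurd h1 (h2' _ h _ hwG)
      · exact h
      · exact absurd h1' (h2 _ h _ hw'G)
    subst hk
    have : w = w' := by
      rcases lt_trichotomy w w' with h | h | h
      · exact absurd h1 (h3' _ h)
      · exact h
      · exact absurd h1' (h3 _ h)
    subst this
    simpa [hb] using hb'
  · rintro rfl
    exact ⟨e, by omega, hact, hlow, w, hwG, hw, hb⟩

/-! ### Convergence of the construction -/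

section Construction

variable {V : ℕ → ℕ → List Bool → Option ℕ} {G : ℕ → ℕ} {X : ℕ → Bool}

/-- If no martingale before the `e`-th acts from `s` on, and at stage `s` the search bound covers the
least value `v` that the `e`-th martingale takes on the extensions of `X ↾ s`, then `X` reaches a
string of value `v`. -/
theorem exists_value_eq_minimal (hV : IsStagedMartingaleFamily V) (hG : Monotone G)
    (hX : ∀ s, X s = true ↔ NextBit V (G s) (initSeg X s)) {e s v w : ℕ} (hes : e ≤ s)
    (hlow : ∀ e' < e, ∀ s' ≥ s, ¬ Acts V (G s') (initSeg X s') e')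
    (hmin : ∀ t τ a, initSeg X s <+: τ → V t e τ = some a → v ≤ a)
    (hw : IsWitness V e (initSeg X s) v w) (hwmin : ∀ w' < w, ¬ IsWitness V e (initSeg X s) v w')
    (hwG : w < G s) :
    ∃ s' ≥ s, ∃ t, V t e (initSeg X s') = some v := by
  by_contra! hne
  have hwτ := isWitness_iff.1 hw
  -- As long as the value `v` is not reached, `w` remains the target: a witness that becomes available
  -- later was already a witness at `X ↾ s`, so it has neither a smaller value nor a smaller number.
  have key : ∀ s' ≥ s, initSeg X s' <+: targetString w := by
    intro s' hs'
    induction s', hs' using Nat.le_induction with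
    | base => exact hwτ.1
    | succ r hr ih =>
      have hGr : w < G r := hwG.trans_le (hG hr)
      have htG : w.unpair.1 ≤ G r := (Nat.unpair_left_le w).trans hGr.le
      obtain ⟨b, hb⟩ := hV.exists_of_prefix ih (hV.mono htG hwτ.2)
      have hvb : v < b :=
        lt_of_le_of_ne (hmin _ _ _ (initSeg_prefix X hr) hb) fun h => hne r hr _ (h ▸ hb)
      have hwr : IsWitness V e (initSeg X r) v w := isWitness_iff.2 ⟨ih, hwτ.2⟩
      have back : ∀ {k w'}, IsWitness V e (initSeg X r) k w' → IsWitness V e (initSeg X s) k w' :=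
        fun h => isWitness_iff.2
          ⟨(initSeg_prefix X hr).trans (isWitness_iff.1 h).1, (isWitness_iff.1 h).2⟩
      have hact : Acts V (G r) (initSeg X r) e := ⟨v, by simpa [hb] using hvb, w, hGr, hwr⟩
      have htar : IsTarget V (G r) (initSeg X r) e w := by
        refine ⟨v, by simpa [hb] using hvb, hwr, fun k' hk' w' _ h => ?_, fun w' hw' h =>
          hwmin w' hw' (back h)⟩
        have := isWitness_iff.1 (back h)
        exact absurd (hmin _ _ _ this.1 this.2) (by omega)
      obtain ⟨ρ, hρ⟩ := ih
      cases ρ with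
      | nil =>
        rw [List.append_nil] at hρ
        exact absurd (hρ ▸ hwτ.2) (hne r hr _)
      | cons i ρ =>
        have hbit : (targetString w)[(initSeg X r).length]? = some i := by
          rw [← hρ]; simp
        have := nextBit_iff_of_isTarget (by rw [length_initSeg]; omega) hact
          (fun e' he' => hlow e' he' r hr) htar hGr hbit
        have hXi : X r = i := by
          rw [Bool.eq_iff_iff, hX, this]
        rw [initSeg_succ, hXi, ← hρ]
        exact ⟨ρ, by simp⟩
  have h1 := (key (s + (targetString w).length + 1) (by omega)).length_le
  rw [length_initSeg] at h1
  omega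

/-- Every martingale of the family is eventually constant along `X`, as far as it is defined there,
and acts only finitely often. The hypothesis `hesc` holds at a stage `s` where the search bound `G s`
exceeds the least witnesses for all the values that a martingale of index at most `s` and initial
capital at most `s` can take on the strings of length `s`. -/
theorem eventually_constant_and_not_acts (hV : IsStagedMartingaleFamily V) (hG : Monotone G)
    (hX : ∀ s, X s = true ↔ NextBit V (G s) (initSeg X s))
    (hesc : ∃ᶠ s in Filter.atTop, ∀ e ≤ s, ∀ k ≤ 2 ^ s * s,
      (∃ w, IsWitness V e (initSeg X s) k w) → ∃ w < G s, IsWitness V e (initSeg X s) k w)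
    (e : ℕ) :
    ∃ s₁ v, ∀ s ≥ s₁, (∀ t a, V t e (initSeg X s) = some a → a = v) ∧
      ¬ Acts V (G s) (initSeg X s) e := by
  classical
  induction e using Nat.strong_induction_on with
  | _ e ih =>
  -- A martingale undefined at some initial segment is undefined, and does not act, from there on.
  by_cases hdom : ∀ s, ∃ t a, V t e (initSeg X s) = some a
  · choose! S v hS using ih
    set s₀ := (Finset.range e).sup S
    obtain ⟨t₀, a₀, ha₀⟩ := hdom 0
    obtain ⟨s, hs, hsesc⟩ := Filter.frequently_atTop.1 hesc (max s₀ (max e a₀))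
    have hs₀ : s₀ ≤ s := (le_max_left _ _).trans hs
    have hes : e ≤ s := (le_max_left _ _).trans ((le_max_right _ _).trans hs)
    have has : a₀ ≤ s := (le_max_right _ _).trans ((le_max_right _ _).trans hs)
    have hlow : ∀ e' < e, ∀ s' ≥ s, ¬ Acts V (G s') (initSeg X s') e' := fun e' he' s' hs' =>
      (hS e' he' s' (((Finset.le_sup (Finset.mem_range.2 he')).trans hs₀).trans hs')).2
    have hex : ∃ k t τ, initSeg X s <+: τ ∧ V t e τ = some k := by
      obtain ⟨t, a, ha⟩ := hdom s
      exact ⟨a, t, _, List.prefix_rfl, ha⟩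
    set m := Nat.find hex
    obtain ⟨t, τ, hτ, hm⟩ := Nat.find_spec hex
    have hmin : ∀ t τ a, initSeg X s <+: τ → V t e τ = some a → m ≤ a :=
      fun t τ a h ha => Nat.find_min' hex ⟨t, τ, h, ha⟩
    have hmle : m ≤ 2 ^ s * s := by
      obtain ⟨t, a, ha⟩ := hdom s
      obtain ⟨c, hc⟩ := hV.exists_of_prefix List.nil_prefix ha
      have h1 := hV.le_two_pow_mul ha hc
      have h2 : c = a₀ := hV.unique hc ha₀
      rw [length_initSeg, h2] at h1
      exact (hmin _ _ _ List.prefix_rfl ha).trans (h1.trans (Nat.mul_le_mul_left _ has))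
    have hexw := exists_isWitness hτ hm
    obtain ⟨w', hw'G, hw'⟩ := hsesc e hes m hmle hexw
    obtain ⟨s₁, hs₁, t₁, ht₁⟩ := exists_value_eq_minimal hV hG hX hes hlow hmin
      (Nat.find_spec hexw) (fun _ h => Nat.find_min hexw h) ((Nat.find_min' hexw hw').trans_lt hw'G)
    have hconst : ∀ t τ a, initSeg X s₁ <+: τ → V t e τ = some a → a = m := fun t τ a h ha =>
      hV.eq_of_minimal ht₁ (fun t τ a h => hmin t τ a ((initSeg_prefix X hs₁).trans h)) h ha
    refine ⟨s₁, m, fun s' hs' => ⟨fun t a ha => hconst t _ a (initSeg_prefix X hs') ha, ?_⟩⟩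
    rintro ⟨k, hk, w, -, hw⟩
    have hw := isWitness_iff.1 hw
    have hkm := hconst _ _ _ ((initSeg_prefix X hs').trans hw.1) hw.2
    cases hb : V (G s') e (initSeg X s') with
    | none => simp [hb] at hk
    | some b =>
      have := hconst _ _ _ (initSeg_prefix X hs') hb
      simp [hb] at hk
      omega
  · push Not at hdom
    obtain ⟨s, hs⟩ := hdom
    have hnone : ∀ s' ≥ s, ∀ t a, V t e (initSeg X s') ≠ some a := fun s' hs' t a ha => by
      obtain ⟨b, hb⟩ := hV.exists_of_prefix (initSeg_prefix X hs') ha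
      exact hs t b hb
    refine ⟨s, 0, fun s' hs' => ⟨fun t a ha => absurd ha (hnone s' hs' t a), ?_⟩⟩
    rintro ⟨k, hk, -⟩
    cases hb : V (G s') e (initSeg X s') with
    | none => simp [hb] at hk
    | some b => exact hnone s' hs' _ _ hb

end Construction

/-! ### Bounded quantifiers over primitive recursive predicates -/

section PrimrecQuantifiers

variable {α : Type*} [Primcodable α]

theorem PrimrecPred.exists_lt_of_primrec {b : α → ℕ} {p : α → ℕ → Prop} (hb : Primrec b)
    (hp : PrimrecPred fun q : α × ℕ => p q.1 q.2) : PrimrecPred fun a => ∃ x < b a, p a x :=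
  ((PrimrecRel.exists_mem_list (R := fun (x : ℕ) (a : α) => p a x)
    (hp.comp (Primrec.pair Primrec.snd Primrec.fst))).comp
      (Primrec.list_range.comp hb) Primrec.id).of_eq (by simp)

theorem PrimrecPred.forall_lt_of_primrec {b : α → ℕ} {p : α → ℕ → Prop} (hb : Primrec b)
    (hp : PrimrecPred fun q : α × ℕ => p q.1 q.2) : PrimrecPred fun a => ∀ x < b a, p a x :=
  ((PrimrecRel.forall_mem_list (R := fun (x : ℕ) (a : α) => p a x)
    (hp.comp (Primrec.pair Primrec.snd Primrec.fst))).comp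
      (Primrec.list_range.comp hb) Primrec.id).of_eq (by simp)

end PrimrecQuantifiers

/-! ### Computability of the next bit -/

section PrimrecConstruction

open Primrec

theorem primrec_targetString : Primrec targetString :=
  option_getD.comp (Primrec.decode.comp (snd.comp unpair)) (const [])

variable {V : ℕ → ℕ → List Bool → Option ℕ}
  (hV : Primrec fun p : ℕ × ℕ × List Bool => V p.1 p.2.1 p.2.2)
  {α : Type*} [Primcodable α]
include hV

theorem primrecPred_isWitness {e : α → ℕ} {σ : α → List Bool} {k w : α → ℕ} (he : Primrec e)
    (hσ : Primrec σ) (hk : Primrec k) (hw : Primrec w) :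
    PrimrecPred fun a => IsWitness V (e a) (σ a) (k a) (w a) :=
  PrimrecPred.and
    (Primrec.eq.comp (list_take.comp (list_length.comp hσ) (primrec_targetString.comp hw)) hσ)
    (Primrec.eq.comp
      (hV.comp ((fst.comp (unpair.comp hw)).pair (he.pair (primrec_targetString.comp hw))))
      (option_some.comp hk))

theorem primrec_seenValue {G : α → ℕ} {σ : α → List Bool} {e : α → ℕ} (hG : Primrec G)
    (hσ : Primrec σ) (he : Primrec e) : Primrec fun a => (V (G a) (e a) (σ a)).getD 0 :=
  option_getD.comp (hV.comp (hG.pair (he.pair hσ))) (const 0)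

theorem primrecPred_acts {G : α → ℕ} {σ : α → List Bool} {e : α → ℕ} (hG : Primrec G)
    (hσ : Primrec σ) (he : Primrec e) : PrimrecPred fun a => Acts V (G a) (σ a) (e a) :=
  .exists_lt_of_primrec (primrec_seenValue hV hG hσ he)
    (.exists_lt_of_primrec (hG.comp fst)
      (primrecPred_isWitness hV (he.comp (fst.comp fst)) (hσ.comp (fst.comp fst))
        (snd.comp fst) snd))

theorem primrecPred_isTarget {G : α → ℕ} {σ : α → List Bool} {e w : α → ℕ} (hG : Primrec G)
    (hσ : Primrec σ) (he : Primrec e) (hw : Primrec w) :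
    PrimrecPred fun a => IsTarget V (G a) (σ a) (e a) (w a) :=
  .exists_lt_of_primrec (primrec_seenValue hV hG hσ he)
    (.and (primrecPred_isWitness hV (he.comp fst) (hσ.comp fst) snd (hw.comp fst))
      (.and
        (.forall_lt_of_primrec snd (.forall_lt_of_primrec (hG.comp (fst.comp fst))
          (.not (primrecPred_isWitness hV (he.comp (fst.comp (fst.comp fst)))
            (hσ.comp (fst.comp (fst.comp fst))) (snd.comp fst) snd))))
        (.forall_lt_of_primrec (hw.comp fst)
          (.not (primrecPred_isWitness hV (he.comp (fst.comp fst)) (hσ.comp (fst.comp fst))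
            (snd.comp fst) snd)))))

theorem primrecPred_nextBit {G : α → ℕ} {σ : α → List Bool} (hG : Primrec G) (hσ : Primrec σ) :
    PrimrecPred fun a => NextBit V (G a) (σ a) :=
  .exists_lt_of_primrec (succ.comp (list_length.comp hσ))
    (.and (primrecPred_acts hV (hG.comp fst) (hσ.comp fst) snd)
      (.and
        (.forall_lt_of_primrec snd
          (.not (primrecPred_acts hV (hG.comp (fst.comp fst)) (hσ.comp (fst.comp fst)) snd)))
        (.exists_lt_of_primrec (hG.comp fst)
          (.and (primrecPred_isTarget hV (hG.comp (fst.comp fst)) (hσ.comp (fst.comp fst))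
              (snd.comp fst) snd)
            (Primrec.eq.comp
              (list_getElem?.comp (primrec_targetString.comp snd)
                (list_length.comp (hσ.comp (fst.comp fst))))
              (const (some true)))))))

end PrimrecConstruction

/-! ### The enumeration of partial computable martingales -/

section Enumeration

open Nat.Partrec

/-- The value at the string `τ` of the partial computable function with index `e`, as far as it is
found within `t` steps. -/
def stepValue (t e : ℕ) (τ : List Bool) : Option ℕ :=
  Code.evaln t (Denumerable.ofNat Code e) (Encodable.encode τ)

/-- Within `t` steps, the function with index `e` is seen to be defined and fair at `ρ`. -/
def isFairAt (t e : ℕ) (ρ : List Bool) : Bool :=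
  ((stepValue t e ρ).bind fun a => (stepValue t e (ρ ++ [false])).bind fun b =>
    (stepValue t e (ρ ++ [true])).map fun c => decide (b + c = 2 * a)).getD false

/-- The staged family of all partial computable `ℕ`-valued martingales: a value of the function with
index `e` is accepted once the function has been seen to be fair at all proper prefixes. -/
def martingaleValue (t e : ℕ) (τ : List Bool) : Option ℕ :=
  if ∀ i < τ.length, isFairAt t e (τ.take i) = true then stepValue t e τ else none

theorem stepValue_mono {t t' e τ a} (h : t ≤ t') (ha : stepValue t e τ = some a) :
    stepValue t' e τ = some a :=
  Code.evaln_mono h ha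

theorem isFairAt_iff {t e ρ} : isFairAt t e ρ = true ↔ ∃ a b c, stepValue t e ρ = some a ∧
    stepValue t e (ρ ++ [false]) = some b ∧ stepValue t e (ρ ++ [true]) = some c ∧
      b + c = 2 * a := by
  unfold isFairAt
  cases stepValue t e ρ <;> cases stepValue t e (ρ ++ [false]) <;>
    cases stepValue t e (ρ ++ [true]) <;> simp

theorem martingaleValue_eq_some {t e τ a} : martingaleValue t e τ = some a ↔
    (∀ i < τ.length, isFairAt t e (τ.take i) = true) ∧ stepValue t e τ = some a := by
  unfold martingaleValue
  split_ifs with h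
  · exact ⟨fun h' => ⟨h, h'⟩, fun h' => h'.2⟩
  · simp [h]

theorem forall_lt_isFairAt_append {t e τ} {i : Bool} :
    (∀ j < (τ ++ [i]).length, isFairAt t e ((τ ++ [i]).take j) = true) ↔
      (∀ j < τ.length, isFairAt t e (τ.take j) = true) ∧ isFairAt t e τ = true := by
  rw [List.length_append, List.length_singleton, Nat.forall_lt_succ_right]
  refine and_congr (forall₂_congr fun j hj => ?_) ?_
  · rw [List.take_append_of_le_length hj.le]
  · rw [List.take_append_of_le_length le_rfl, List.take_length]

theorem isStagedMartingaleFamily_martingaleValue :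
    IsStagedMartingaleFamily martingaleValue where
  mono := by
    intro t t' e τ a h ha
    rw [martingaleValue_eq_some] at ha ⊢
    refine ⟨fun i hi => ?_, stepValue_mono h ha.2⟩
    obtain ⟨a, b, c, h1, h2, h3, h4⟩ := isFairAt_iff.1 (ha.1 i hi)
    exact isFairAt_iff.2
      ⟨a, b, c, stepValue_mono h h1, stepValue_mono h h2, stepValue_mono h h3, h4⟩
  fair := by
    intro t e τ i a ha
    simp only [martingaleValue_eq_some, forall_lt_isFairAt_append] at ha ⊢
    obtain ⟨⟨hτ, hfair⟩, ha⟩ := ha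
    obtain ⟨x, b, c, h1, h2, h3, h4⟩ := isFairAt_iff.1 hfair
    cases i with
    | false =>
      rw [h2, Option.some_inj] at ha
      exact ⟨x, c, ⟨hτ, h1⟩, ⟨⟨hτ, hfair⟩, h3⟩, by omega⟩
    | true =>
      rw [h3, Option.some_inj] at ha
      exact ⟨x, b, ⟨hτ, h1⟩, ⟨⟨hτ, hfair⟩, h2⟩, by omega⟩

open Primrec

theorem primrec_stepValue {α : Type*} [Primcodable α] {t e : α → ℕ} {τ : α → List Bool}
    (ht : Primrec t) (he : Primrec e) (hτ : Primrec τ) :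
    Primrec fun a => stepValue (t a) (e a) (τ a) :=
  Code.primrec_evaln.comp ((ht.pair ((Primrec.ofNat Code).comp he)).pair (Primrec.encode.comp hτ))

theorem primrec_isFairAt {α : Type*} [Primcodable α] {t e : α → ℕ} {ρ : α → List Bool}
    (ht : Primrec t) (he : Primrec e) (hρ : Primrec ρ) :
    Primrec fun a => isFairAt (t a) (e a) (ρ a) := by
  refine option_getD.comp (option_bind (primrec_stepValue ht he hρ) ?_) (const false)
  refine option_bind (primrec_stepValue (ht.comp fst) (he.comp fst)
    (list_append.comp (hρ.comp fst) (const [false]))) ?_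
  refine option_map (primrec_stepValue (ht.comp (fst.comp fst)) (he.comp (fst.comp fst))
    (list_append.comp (hρ.comp (fst.comp fst)) (const [true]))) ?_
  exact (Primrec.eq.comp (nat_add.comp (snd.comp fst) snd)
    (nat_mul.comp (const 2) (snd.comp (fst.comp fst)))).decide

theorem primrec_martingaleValue :
    Primrec fun p : ℕ × ℕ × List Bool => martingaleValue p.1 p.2.1 p.2.2 := by
  refine Primrec.ite (.forall_lt_of_primrec (list_length.comp (snd.comp snd))
    (Primrec.eq.comp (primrec_isFairAt (fst.comp fst) (fst.comp (snd.comp fst))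
      (list_take.comp snd (snd.comp (snd.comp fst)))) (const true)))
    (primrec_stepValue fst (fst.comp snd) (snd.comp snd)) (const none)

end Enumeration

/-! ### Bounds reducible to the halting set -/

theorem getElem?_initSeg {X : ℕ → Bool} {n i : ℕ} (h : i < n) : (initSeg X n)[i]? = some (X i) := by
  simp [initSeg, h]

section WttBound

open Nat.Partrec Computable

/-- The halting set decides whether a witness exists, uniformly in the question `x`. -/
theorem exists_computable_index {R : ℕ → ℕ → Prop} (hR : PrimrecRel R) :
    ∃ q : ℕ → ℕ, Computable q ∧ ∀ x, haltingSet (q x) = true ↔ ∃ w, R x w := by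
  classical
  have hp : Partrec fun p : ℕ => Nat.rfind fun w => Part.some (decide (R p.unpair.1 w)) := by
    refine Partrec.rfind (Computable.partrec (Primrec.to_comp ?_))
    exact (hR.comp (Primrec.fst.comp (Primrec.unpair.comp Primrec.fst)) Primrec.snd).decide
  obtain ⟨c, hc⟩ := Code.exists_code.1 (Partrec.nat_iff.1 hp)
  refine ⟨fun x => Encodable.encode (Code.curry c x),
    (Primrec.encode.comp (Code.primrec₂_curry.comp (Primrec.const c) Primrec.id)).to_comp,
    fun x => ?_⟩
  rw [haltingSet, decide_eq_true_iff, Denumerable.ofNat_encode, Code.eval_curry, hc]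
  simp only [Nat.unpair_pair]
  constructor
  · intro h
    exact ⟨_, by simpa using Nat.rfind_spec (Part.get_mem h)⟩
  · rintro ⟨w, hw⟩
    obtain ⟨n, hn, -⟩ := Nat.rfind_min' (p := fun w => decide (R x w)) (by simpa using hw)
    exact Part.dom_iff_mem.2 ⟨n, hn⟩

/-- Boundedly many `Σ₁` questions have a common bound on the least witnesses that is weak truth-table
reducible to the halting set: the use is the largest index of a question, and a witness is searched
for exactly when the halting set says that there is one. -/
theorem exists_wttReducible_witness_bound {R : ℕ → ℕ → Prop} (hR : PrimrecRel R) {B : ℕ → ℕ}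
    (hB : Computable B) :
    ∃ f : ℕ → ℕ, WttReducible f haltingSet ∧
      ∀ n, ∀ x < B n, (∃ w, R x w) → ∃ w ≤ f n, R x w := by
  classical
  obtain ⟨q, hq, hqR⟩ := exists_computable_index hR
  let u : ℕ → ℕ := fun n => Nat.rec 0 (fun x a => a + (q x + 1)) n
  have hu : Computable u :=
    Computable.nat_rec Computable.id (Computable.const 0)
      ((Primrec.nat_add.to_comp.comp (snd.comp snd)
        (Computable.succ.comp (hq.comp (fst.comp snd)))).to₂)
  have hu_lt : ∀ m, ∀ x < m, q x < u m := by
    intro m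
    induction m with
    | zero => simp
    | succ m ih =>
      intro x hx
      have h : u (m + 1) = u m + (q m + 1) := rfl
      rcases Nat.lt_succ_iff_lt_or_eq.1 hx with hx | rfl
      · have := ih x hx; omega
      · omega
  let least : ℕ → ℕ := fun x => if h : ∃ w, R x w then Nat.find h else 0
  let f : ℕ → ℕ := fun m => Nat.rec 0 (fun x a => a + least x) m
  have hf : ∀ m, ∀ x < m, least x ≤ f m := by
    intro m
    induction m with
    | zero => simp
    | succ m ih =>
      intro x hx
      have h : f (m + 1) = f m + least m := rfl
      rcases Nat.lt_succ_iff_lt_or_eq.1 hx with hx | rfl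
      · have := ih x hx; omega
      · omega
  let search : ℕ →. ℕ := fun x => Nat.rfind fun w => Part.some (decide (R x w))
  have hsearch : Partrec search :=
    Partrec.rfind (Computable.partrec (Primrec.to_comp hR.decide))
  have mem_search : ∀ x, (∃ w, R x w) → least x ∈ search x := by
    intro x hx
    have hl : least x = Nat.find hx := dif_pos hx
    rw [hl]
    refine Nat.mem_rfind.2 ⟨?_, fun {m} hm => ?_⟩
    · simpa using Nat.find_spec hx
    · simpa using Nat.find_min hx hm
  let Φ : ℕ × List Bool →. ℕ := fun p => Nat.rec (Part.some 0) (fun x IH => IH.bind fun a =>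
    cond ((p.2[q x]?).getD false) ((search x).map fun w => a + w) (Part.some a)) (B p.1)
  have hΦ : Partrec Φ := by
    refine Partrec.nat_rec (h := fun (p : ℕ × List Bool) (y : ℕ × ℕ) =>
      cond ((p.2[q y.1]?).getD false)
      ((search y.1).map fun w => y.2 + w) (Part.some y.2)) (hB.comp fst)
      (Computable.const 0).partrec ?_
    refine Partrec.cond ?_ ?_ ?_
    · exact Computable.option_getD (Computable.list_getElem?.comp (snd.comp fst)
        (hq.comp (fst.comp snd))) (Computable.const false)
    · exact Partrec.map (hsearch.comp (fst.comp snd))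
        ((Primrec.nat_add.to_comp.comp (snd.comp (snd.comp fst)) snd).to₂)
    · exact (snd.comp snd).partrec
  refine ⟨fun n => f (B n), ⟨fun n => u (B n), hu.comp hB, Φ, hΦ, fun n => ?_⟩, ?_⟩
  · suffices ∀ (L : List Bool) (m : ℕ), (∀ x < m, L[q x]? = some (haltingSet (q x))) →
        f m ∈ (Nat.rec (Part.some 0) (fun x IH => IH.bind fun a =>
          cond ((L[q x]?).getD false) ((search x).map fun w => a + w) (Part.some a)) m :
            Part ℕ) from
      this _ _ fun x hx => getElem?_initSeg (hu_lt _ _ hx)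
    intro L m
    induction m with
    | zero => exact fun _ => Part.mem_some 0
    | succ m ih =>
      intro hL
      refine Part.mem_bind_iff.2 ⟨f m, ih fun x hx => hL x (by omega), ?_⟩
      rw [hL m (by omega), Option.getD_some]
      cases hm : haltingSet (q m) with
      | true => exact Part.mem_map (fun w => f m + w) (mem_search m ((hqR m).1 hm))
      | false =>
        have hno : ¬ ∃ w, R m w := fun h => by simp [(hqR m).2 h] at hm
        have hl : least m = 0 := dif_neg hno
        have : f (m + 1) = f m + least m := rfl
        simp [this, hl]
  · intro n x hx h
    refine ⟨least x, hf _ _ hx, ?_⟩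
    have hl : least x = Nat.find h := dif_pos h
    rw [hl]
    exact Nat.find_spec h

end WttBound

/-! ### A bound on the witnesses -/

/-- A bound on the codes of the strings of length `s`. -/
def stringCodeBound : ℕ → ℕ :=
  fun s => Nat.rec 0 (fun _ b => Nat.pair 1 b + 1) s

theorem primrec_stringCodeBound : Primrec stringCodeBound :=
  Primrec.nat_rec₁ 0 (Primrec.succ.comp (Primrec₂.natPair.comp (Primrec.const 1) Primrec.snd)).to₂

theorem nat_pair_le_pair {a b c d : ℕ} (hac : a ≤ c) (hbd : b ≤ d) :
    Nat.pair a b ≤ Nat.pair c d := by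
  calc Nat.pair a b ≤ Nat.pair c b := by
        rcases hac.eq_or_lt with rfl | h
        · exact le_rfl
        · exact (Nat.pair_lt_pair_left b h).le
    _ ≤ Nat.pair c d := by
        rcases hbd.eq_or_lt with rfl | h
        · exact le_rfl
        · exact (Nat.pair_lt_pair_right c h).le

theorem encode_le_stringCodeBound (σ : List Bool) :
    Encodable.encode σ ≤ stringCodeBound σ.length := by
  induction σ with
  | nil => exact le_rfl
  | cons b σ ih =>
    have hb : Encodable.encode b ≤ 1 := by cases b <;> decide
    exact Nat.succ_le_succ (nat_pair_le_pair hb ih)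

/-- A bound, weak truth-table reducible to the halting set, on the least witnesses for all martingales
and values that can matter at a string of length `s`. The questions are numbered by coding index,
string and value into one number, and `2 ^ s * s` bounds the values on strings of length `s` of the
martingales with initial capital at most `s`. -/
theorem exists_wttReducible_isWitness_bound {V : ℕ → ℕ → List Bool → Option ℕ}
    (hV : Primrec fun p : ℕ × ℕ × List Bool => V p.1 p.2.1 p.2.2) :
    ∃ f : ℕ → ℕ, WttReducible f haltingSet ∧
      ∀ σ : List Bool, ∀ e ≤ σ.length, ∀ k ≤ 2 ^ σ.length * σ.length,
        (∃ w, IsWitness V e σ k w) → ∃ w ≤ f σ.length, IsWitness V e σ k w := by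
  let dec : ℕ → ℕ × List Bool × ℕ := fun x =>
    (Encodable.decode (α := ℕ × List Bool × ℕ) x).getD (0, [], 0)
  have hdec : Primrec dec := Primrec.option_getD.comp Primrec.decode (Primrec.const _)
  have hdec' : ∀ y, dec (Encodable.encode y) = y := fun y => by
    simp only [dec, Encodable.encodek, Option.getD_some]
  have hR : PrimrecRel fun x w => IsWitness V (dec x).1 (dec x).2.1 (dec x).2.2 w :=
    primrecPred_isWitness hV (Primrec.fst.comp (hdec.comp Primrec.fst))
      (Primrec.fst.comp (Primrec.snd.comp (hdec.comp Primrec.fst)))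
      (Primrec.snd.comp (Primrec.snd.comp (hdec.comp Primrec.fst))) Primrec.snd
  have hpow : Primrec fun s : ℕ => 2 ^ s := by
    refine (Primrec.nat_rec₁ 1 (Primrec.nat_mul.comp Primrec.snd (Primrec.const 2)).to₂).of_eq ?_
    intro n
    induction n with
    | zero => rfl
    | succ n ih => rw [pow_succ, ← ih]
  have hB : Primrec fun s : ℕ => Nat.pair s (Nat.pair (stringCodeBound s) (2 ^ s * s)) + 1 :=
    Primrec.succ.comp (Primrec₂.natPair.comp Primrec.id (Primrec₂.natPair.comp
      primrec_stringCodeBound (Primrec.nat_mul.comp hpow Primrec.id)))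
  obtain ⟨f, hf, hfw⟩ := exists_wttReducible_witness_bound hR hB.to_comp
  refine ⟨f, hf, fun σ e he k hk h => ?_⟩
  have := hfw σ.length (Encodable.encode (e, σ, k)) ?_ ?_
  · simpa only [hdec'] using this
  · exact Nat.lt_succ_of_le
      (nat_pair_le_pair he (nat_pair_le_pair (encode_le_stringCodeBound σ) hk))
  · simpa only [hdec'] using h

/-! ### Primitive recursion relative to an oracle -/

section TuringReduction

theorem turingReducible_nat_rec {A : ℕ →. ℕ} {g : ℕ → ℕ} (hg : (g : ℕ →. ℕ) ≤ᵀ A)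
    {step : ℕ → ℕ → ℕ} (hstep : Computable₂ step) (z : ℕ) :
    ((fun n => Nat.rec z (fun s v => step (g s) v) n : ℕ → ℕ) : ℕ →. ℕ) ≤ᵀ A := by
  have hg' : Nat.RecursiveIn {A} (g : ℕ →. ℕ) := RecursiveIn.iff_nat.1 hg
  refine RecursiveIn.iff_nat.2 ?_
  have hz : Nat.RecursiveIn {A} (fun _ : ℕ => Part.some z) :=
    (Nat.Primrec.const z).recursiveIn
  have hs : Nat.RecursiveIn {A} fun p : ℕ => Part.some (step p.unpair.1 p.unpair.2) :=
    (Partrec.nat_iff.1 (hstep.comp (Computable.fst.comp Computable.unpair)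
      (Computable.snd.comp Computable.unpair)).partrec).recursiveIn
  have h0 : Nat.RecursiveIn {A} fun p : ℕ => Part.some p.unpair.2.unpair.1 :=
    (Nat.RecursiveIn.left.comp Nat.RecursiveIn.right).of_eq fun n => by simp
  have h1 : Nat.RecursiveIn {A} fun p : ℕ => Part.some (g p.unpair.2.unpair.1) :=
    (hg'.comp h0).of_eq fun n => Part.bind_some _ _
  have h2 : Nat.RecursiveIn {A} fun p : ℕ => Part.some (p.unpair.2.unpair.2) :=
    (Nat.RecursiveIn.right.comp Nat.RecursiveIn.right).of_eq fun n => by simp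
  have h3 : Nat.RecursiveIn {A} fun p : ℕ =>
      Part.some (step (g p.unpair.2.unpair.1) p.unpair.2.unpair.2) :=
    (hs.comp (h1.pair h2)).of_eq fun n => by simp [Seq.seq]
  have hid : Nat.RecursiveIn {A} fun n : ℕ => Part.some (Nat.pair 0 n) :=
    (Nat.Partrec.recursiveIn (Partrec.nat_iff.1
      (Primrec₂.natPair.comp (Primrec.const 0) Primrec.id).to_comp.partrec))
  refine ((Nat.RecursiveIn.prec hz h3).comp hid).of_eq fun n => ?_
  simp only [Part.bind_eq_bind, Part.bind_some, Nat.unpair_pair]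
  induction n with
  | zero => rfl
  | succ n ih => simp only [ih, PFun.coe_val, Part.bind_some]

theorem turingReducible_comp {A : ℕ →. ℕ} {f h : ℕ → ℕ} (hf : Computable f)
    (hh : (h : ℕ →. ℕ) ≤ᵀ A) : ((fun n => f (h n) : ℕ → ℕ) : ℕ →. ℕ) ≤ᵀ A := by
  refine RecursiveIn.iff_nat.2 ?_
  have hf' : Nat.RecursiveIn {A} (f : ℕ →. ℕ) :=
    (Partrec.nat_iff.1 hf.partrec).recursiveIn
  exact (hf'.comp (RecursiveIn.iff_nat.1 hh)).of_eq fun n => Part.bind_some _ _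

theorem turingReducible_comp_succ {A : ℕ →. ℕ} {h : ℕ → ℕ}
    (hh : (h : ℕ →. ℕ) ≤ᵀ A) : ((fun n => h (n + 1) : ℕ → ℕ) : ℕ →. ℕ) ≤ᵀ A := by
  refine RecursiveIn.iff_nat.2 ?_
  exact ((RecursiveIn.iff_nat.1 hh).comp Nat.RecursiveIn.succ).of_eq fun n => Part.bind_some _ _

/-! ### The real computed from a search bound -/

variable (next : ℕ → List Bool → Bool) (g : ℕ → ℕ)

/-- The search bounds obtained from `g`: stage `s` uses the entry for `s + 1`, which exceeds
`g s`. -/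
def searchBound (s : ℕ) : ℕ := Nat.rec 0 (fun t c => c + g t + 1) s

/-- The initial segments of the real whose next bit after `σ` at stage `s` is chosen by `next` from
the search bound and `σ`. -/
def path (s : ℕ) : List Bool := Nat.rec [] (fun t σ => σ ++ [next (searchBound g (t + 1)) σ]) s

/-- The real with the initial segments `path next g`. -/
def pathReal (s : ℕ) : Bool := next (searchBound g (s + 1)) (path next g s)

theorem path_eq_initSeg (s : ℕ) : path next g s = initSeg (pathReal next g) s := by
  induction s with
  | zero => rfl
  | succ s ih => rw [initSeg_succ, ← ih]; rfl

theorem searchBound_strictMono : StrictMono (searchBound g) :=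
  strictMono_nat_of_lt_succ fun n => show searchBound g n < searchBound g n + g n + 1 by omega

theorem lt_searchBound_succ (s : ℕ) : g s < searchBound g (s + 1) :=
  show g s < searchBound g s + g s + 1 by omega

theorem realFun_pathReal_turingReducible {A : ℕ →. ℕ} (hg : (g : ℕ →. ℕ) ≤ᵀ A)
    (hnext : Computable₂ next) : realFun (pathReal next g) ≤ᵀ A := by
  -- The recursion runs on codes of pairs of a search bound and an initial segment.
  let dec : ℕ → ℕ × List Bool := fun v => (Encodable.decode (α := ℕ × List Bool) v).getD (0, [])
  have hdec : Computable dec := (Primrec.option_getD.comp Primrec.decode (Primrec.const _)).to_comp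
  let step : ℕ → ℕ → ℕ := fun b v => Encodable.encode
    ((dec v).1 + b + 1, (dec v).2 ++ [next ((dec v).1 + b + 1) (dec v).2])
  have hstep : Computable₂ step := by
    have hb : Computable fun p : ℕ × ℕ => (dec p.2).1 + p.1 + 1 :=
      Computable.succ.comp (Primrec.nat_add.to_comp.comp
        (Computable.fst.comp (hdec.comp Computable.snd)) Computable.fst)
    have hσ : Computable fun p : ℕ × ℕ => (dec p.2).2 :=
      Computable.snd.comp (hdec.comp Computable.snd)
    exact Computable.encode.comp (hb.pair (Computable.list_concat.comp hσ (hnext.comp hb hσ)))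
  have hrec := turingReducible_nat_rec hg hstep (Encodable.encode ((0, []) : ℕ × List Bool))
  have hstate : ∀ n, (Nat.rec (Encodable.encode ((0, []) : ℕ × List Bool))
      (fun s v => step (g s) v) n : ℕ) = Encodable.encode (searchBound g n, path next g n) := by
    intro n
    induction n with
    | zero => rfl
    | succ n ih => simp only [ih, step, dec, Encodable.encodek, Option.getD_some]; rfl
  simp only [hstate] at hrec
  let last : ℕ → ℕ := fun v => ((dec v).2.reverse.headI).toNat
  have hlast : Computable last := by
    refine Primrec.to_comp (Primrec.comp (Primrec.dom_bool _) (Primrec.list_headI.comp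
      (Primrec.list_reverse.comp (Primrec.snd.comp
        (Primrec.option_getD.comp Primrec.decode (Primrec.const _))))))
  have := turingReducible_comp_succ (turingReducible_comp hlast hrec)
  refine this.of_eq fun n => ?_
  have : path next g (n + 1) = path next g n ++ [pathReal next g n] := rfl
  simp [last, dec, this, realFun]

end TuringReduction

/-! ### Integer-valued martingales as functions with natural values -/

/-- Two values of an integer-valued martingale differ by an integer. -/
theorem IsIntegerValued.exists_int_sub_eq {f : List Bool →. ℝ} (hi : IsIntegerValued f)
    {a : ℝ} (ha : a ∈ f []) {σ : List Bool} {x : ℝ} (hx : x ∈ f σ) :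
    ∃ z : ℤ, x - a = z := by
  induction σ using List.reverseRecOn generalizing x with
  | nil => exact ⟨0, by rw [Part.mem_unique hx ha]; simp⟩
  | append_singleton σ i ih =>
    obtain ⟨k, y, hy, x', hx', h⟩ := hi σ i (Part.dom_iff_mem.2 ⟨x, hx⟩)
    obtain ⟨z, hz⟩ := ih hy
    rw [Part.mem_unique hx hx']
    rcases h with h | h
    · exact ⟨z + k, by push_cast; linarith⟩
    · exact ⟨z - k, by push_cast; linarith⟩

/-- A partial computable integer-valued martingale `f` differs by a real constant from a partial
computable function with values in `ℕ`: the values of `f` differ by integers, so they are known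
exactly, up to the constant, from approximations. -/
theorem exists_partrec_nat_translate {f : List Bool →. ℝ}
    (hi : IsIntegerValued f) (hc : IsPartialComputableReal f) {a : ℝ} (ha : a ∈ f []) :
    ∃ q : List Bool →. ℕ, ∃ d : ℝ, Partrec q ∧ (∀ σ, (q σ).Dom ↔ (f σ).Dom) ∧
      ∀ σ, ∀ x ∈ f σ, ∀ y ∈ q σ, (y : ℝ) = x + d := by
  obtain ⟨g, hg, hdom, happ⟩ := hc
  obtain ⟨p₀, hp₀⟩ := Part.dom_iff_mem.1 ((hdom [] 3).2 (Part.dom_iff_mem.2 ⟨a, ha⟩))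
  -- The approximations `p` and `p₀` of `8 x` and `8 a` have error at most `1`, so `p - p₀` is
  -- within `2` of the multiple `8 (x - a)` of `8`, and adding `4` makes rounding down exact. The
  -- further multiple `8 (p₀ + 1)` keeps everything nonnegative.
  refine ⟨fun σ => (g (σ, 3)).map fun p => (p + (7 * p₀ + 12)) / 8, p₀ + 1 - a, ?_, ?_, ?_⟩
  · exact Partrec.map (hg.comp (Computable.id.pair (Computable.const 3)))
      ((Primrec.nat_div.to_comp.comp (Primrec.nat_add.to_comp.comp Computable.snd
        (Computable.const _)) (Computable.const 8)).to₂)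
  · intro σ
    exact hdom σ 3
  · intro σ x hx y hy
    obtain ⟨p, hp, rfl⟩ := (Part.mem_map_iff _).1 hy
    obtain ⟨z, hz⟩ := hi.exists_int_sub_eq ha hx
    have h1 := abs_le.1 (happ σ 3 p hp x hx)
    have h2 := abs_le.1 (happ [] 3 p₀ hp₀ a ha)
    have h3 : (-2 : ℝ) ≤ p - p₀ - 8 * z := by rw [← hz]; linarith [h1.1, h2.2]
    have h4 : (p - p₀ - 8 * z : ℝ) ≤ 2 := by rw [← hz]; linarith [h1.2, h2.1]
    have h3' : (-2 : ℤ) ≤ p - p₀ - 8 * z := by exact_mod_cast h3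
    have h4' : (p - p₀ - 8 * z : ℤ) ≤ 2 := by exact_mod_cast h4
    have h5 : (((p + (7 * p₀ + 12)) / 8 : ℕ) : ℤ) = z + p₀ + 1 := by
      push_cast
      omega
    have h6 : (((p + (7 * p₀ + 12)) / 8 : ℕ) : ℝ) = z + p₀ + 1 := by
      rw [← Int.cast_natCast, h5]
      push_cast
      ring
    rw [h6]
    linarith

open Nat.Partrec in
/-- Every partial computable integer-valued martingale that is defined somewhere is, up to a real
constant, a member of the family `martingaleValue`. -/
theorem exists_martingaleValue_translate {f : List Bool →. ℝ} (hf : IsPartialMartingale f)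
    (hi : IsIntegerValued f) (hc : IsPartialComputableReal f) (h0 : (f []).Dom) :
    ∃ e : ℕ, ∃ d : ℝ, ∀ σ, ∀ x ∈ f σ, ∃ t y, martingaleValue t e σ = some y ∧ (y : ℝ) = x + d := by
  obtain ⟨a, ha⟩ := Part.dom_iff_mem.1 h0
  obtain ⟨q, d, hq, hdom, hval⟩ := exists_partrec_nat_translate hi hc ha
  obtain ⟨c, hcode⟩ := Code.exists_code.1 hq
  have hstep : ∀ {σ y}, y ∈ q σ → ∃ t, stepValue t (Encodable.encode c) σ = some y := by
    intro σ y hy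
    have : y ∈ Code.eval c (Encodable.encode σ) := by
      rw [hcode]; simpa using hy
    obtain ⟨t, ht⟩ := Code.evaln_complete.1 this
    exact ⟨t, by simpa [stepValue] using ht⟩
  have hex : ∀ {σ x}, x ∈ f σ → ∃ y ∈ q σ, (y : ℝ) = x + d := by
    intro σ x hx
    obtain ⟨y, hy⟩ := Part.dom_iff_mem.1 ((hdom σ).2 (Part.dom_iff_mem.2 ⟨x, hx⟩))
    exact ⟨y, hy, hval σ x hx y hy⟩
  refine ⟨Encodable.encode c, d, fun σ => ?_⟩
  induction σ using List.reverseRecOn with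
  | nil =>
    intro x hx
    obtain ⟨y, hy, hyx⟩ := hex hx
    obtain ⟨t, ht⟩ := hstep hy
    exact ⟨t, y, martingaleValue_eq_some.2 ⟨by simp, ht⟩, hyx⟩
  | append_singleton σ i ih =>
    intro x hx
    obtain ⟨a, ha, b, hb, c, hc, habc⟩ := hf.fair σ i (Part.dom_iff_mem.2 ⟨x, hx⟩)
    obtain ⟨t₁, y₁, ht₁, hy₁⟩ := ih a ha
    obtain ⟨y₂, hy₂q, hy₂⟩ := hex hb
    obtain ⟨t₂, ht₂⟩ := hstep hy₂q
    obtain ⟨y₃, hy₃q, hy₃⟩ := hex hc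
    obtain ⟨t₃, ht₃⟩ := hstep hy₃q
    obtain ⟨y, hyq, hy⟩ := hex hx
    obtain ⟨t, ht⟩ := hstep hyq
    set T := t₁ + t₂ + t₃ + t
    have h₁ := martingaleValue_eq_some.1 (isStagedMartingaleFamily_martingaleValue.mono
      (show t₁ ≤ T by omega) ht₁)
    refine ⟨T, y, martingaleValue_eq_some.2 ⟨forall_lt_isFairAt_append.2 ⟨h₁.1, ?_⟩,
      stepValue_mono (show t ≤ T by omega) ht⟩, hy⟩
    refine isFairAt_iff.2 ⟨y₁, y₂, y₃, h₁.2, stepValue_mono (show t₂ ≤ T by omega) ht₂,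
      stepValue_mono (show t₃ ≤ T by omega) ht₃, ?_⟩
    have : (y₂ + y₃ : ℝ) = 2 * y₁ := by rw [hy₁, hy₂, hy₃, habc]; ring
    exact_mod_cast this

/-- A real along which every member of the family `martingaleValue` is eventually constant is
partial integer-valued random. -/
theorem isPartialIntegerValuedRandom_of_eventually_constant {X : ℕ → Bool}
    (hX : ∀ e, ∃ s₁ v, ∀ s ≥ s₁, ∀ t a, martingaleValue t e (initSeg X s) = some a → a = v) :
    IsPartialIntegerValuedRandom X := by
  intro f hf hi hc hs
  obtain ⟨e, d, he⟩ := exists_martingaleValue_translate hf hi hc (hs.1 0)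
  obtain ⟨s₁, v, hv⟩ := hX e
  obtain ⟨s, hs₁, a, ha, hlt⟩ := Filter.frequently_atTop.1 (hs.2 (v - d)) s₁
  obtain ⟨t, y, hy, hya⟩ := he _ a ha
  rw [hv s hs₁ t y hy] at hya
  linarith

theorem IsPartialIntegerValuedRandom.isIntegerValuedRandom {X : ℕ → Bool}
    (h : IsPartialIntegerValuedRandom X) : IsIntegerValuedRandom X :=
  fun f => h f

/-- At a stage `s` with `f s < g s`, where `f` is a bound on the least witnesses that is weak
truth-table reducible to the halting set, the search with a bound above `g s` finds them all. -/
theorem ArrayNoncomputable.exists_turingReducible_random {A : ℕ → Bool}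
    (hA : ArrayNoncomputable A) :
    ∃ X : ℕ → Bool, realFun X ≤ᵀ realFun A ∧ IsPartialIntegerValuedRandom X := by
  classical
  obtain ⟨f, hf, hfw⟩ := exists_wttReducible_isWitness_bound primrec_martingaleValue
  obtain ⟨g, hg, hfg⟩ := hA f hf
  let next : ℕ → List Bool → Bool := fun c σ => decide (NextBit martingaleValue c σ)
  have hnext : Computable₂ next :=
    (primrecPred_nextBit primrec_martingaleValue Primrec.fst Primrec.snd).decide.to_comp
  refine ⟨pathReal next g, realFun_pathReal_turingReducible next g hg hnext,
    isPartialIntegerValuedRandom_of_eventually_constant fun e => ?_⟩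
  obtain ⟨s₁, v, h⟩ := eventually_constant_and_not_acts isStagedMartingaleFamily_martingaleValue
    (G := fun s => searchBound g (s + 1)) (X := pathReal next g)
    (fun a b hab => (searchBound_strictMono g).monotone (by omega))
    (fun s => by rw [← path_eq_initSeg]; exact decide_eq_true_iff)
    (hfg.mono fun s hs e he k hk hw => by
      obtain ⟨w, hwf, hw⟩ := hfw (initSeg (pathReal next g) s) e (by rwa [length_initSeg]) k
        (by rwa [length_initSeg]) hw
      rw [length_initSeg] at hwf
      exact ⟨w, (hwf.trans_lt hs).trans (lt_searchBound_succ g s), hw⟩) e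
  exact ⟨s₁, v, fun s hs => (h s hs).1⟩

theorem mainTheorem7 (d : TuringDegree) (hd : ArrayNoncomputableDegree d) :
    ∃ X : ℕ → Bool, realDegree X ≤ d ∧
      IsPartialIntegerValuedRandom X ∧ IsIntegerValuedRandom X := by
  obtain ⟨A, rfl, hA⟩ := hd
  obtain ⟨X, hXA, hX⟩ := hA.exists_turingReducible_random
  exact ⟨X, hXA, hX, hX.isIntegerValuedRandom⟩
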